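/- Let $1\le k\le n$ be integers and let $\mathbb H^n=\mathbb R^n\times\mathbb R^n\times\mathbb R$ be the Heisenberg group with operation $$(x,y,t)(x',y',t')=\Big(x+x',\,y+y',\,t+t'+\tfrac12\sum_{j=1}^n(x_jy_j'-x_j'y_j)\Big)$$ and dilations $\delta_\lambda(x,y,t)=(\lambda x,\lambda y,\lambda^2t)$, $\lambda>0$. Let $\rho$ be a homogeneous distance on $\mathbb H^n$, i.e. a distance with $\rho(gp,gq)=\rho(p,q)$ and $\rho(\delta_\lambda p,\delta_\lambda q)=\lambda\rho(p,q)$ for all $g,p,q\in\mathbb H^n$ and $\lambda>0$, and assume that $\rho$ is rotationally invariant: $\rho(0,(x,y,t))=\rho(0,(x',y',t))$ whenever $|(x,y)|=|(x',y')|$, where $|\cdot|$ is the Euclidean norm of $\mathbb R^{2n}$. For $E\subset\mathbb H^n$ and $d\ge 0$ let $$\mathcal S^d(E)=\lim_{\varepsilon\to0^+}\inf\Big\{\sum_{j\in\mathbb N}(2r_j)^d:\ E\subset\bigcup_{j\in\mathbb N}\overline B_\rho(p_j,r_j),\ p_j\in\mathbb H^n,\ 2r_j<\varepsilon\Big\}$$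 be the spherical Hausdorff measure of $\rho$, where $\overline B_\rho(p,r)$ is the closed ball, and let $\mathcal H^d_E$ be the Euclidean Hausdorff measure on $\mathbb R^{2n+1}\equiv\mathbb H^n$. Both are regarded as outer measures, and $\mu\llcorner P$ denotes the outer measure $A\mapsto\mu(A\cap P)$. Then there is a constant $c=c(n,k)\in(0,\infty)$ (depending on $n$, $k$ and $\rho$ only) such that $$c\,\mathcal S^{2n+2-k}\llcorner\mathbb P=\mathcal H_E^{2n+1-k}\llcorner\mathbb P$$ for every vertical subgroup $\mathbb P$ of $\mathbb H^n$ of codimension $k$, that is, for every subgroup $\mathbb P$ that satisfies $\delta_\lambda(\mathbb P)=\mathbb P$ for all $\lambda>0$, contains $\{(0,0,t):t\in\mathbb R\}$ and has topological dimension $2n+1-k$. The same equality, with the same $c$, holds for every $\mathbb P\in\mathscr T_{\mathbb H^n,\mathbb R^k}$, the set of normal subgroups of $\mathbb H^n$ that are invariant under all dilations, are the kernel of a surjective homomorphism $L:\mathbb H^n\to\mathbb R^k$ with $L\circ\delta_\lambda=\lambda L$ for all $\lambda>0$, and admit a dilation-invariant subgroup $\mathbb V$ with $\mathbb V\cap\mathbb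 P=\{0\}$ and $\mathbb P\mathbb V=\mathbb H^n$ (this is the same class of subgroups). -/

import Mathlib

open MeasureTheory
open scoped ENNReal NNReal

/-- The Heisenberg group `ℍⁿ` in exponential coordinates `(z, t)`, with `z = (x, y) ∈ ℝⁿ × ℝⁿ`:
`x_j = z (Sum.inl j)` and `y_j = z (Sum.inr j)`. -/
@[ext]
structure Heis (n : ℕ) where
  z : EuclideanSpace ℝ (Fin n ⊕ Fin n)
  t : ℝ

namespace Heis

variable {n : ℕ}

/-- `∑ⱼ (xⱼ y'ⱼ - x'ⱼ yⱼ)`. -/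
def symp (z z' : EuclideanSpace ℝ (Fin n ⊕ Fin n)) : ℝ :=
  ∑ j : Fin n, (z (Sum.inl j) * z' (Sum.inr j) - z' (Sum.inl j) * z (Sum.inr j))

noncomputable instance : Mul (Heis n) := ⟨fun p q => ⟨p.z + q.z, p.t + q.t + (1 / 2) * symp p.z q.z⟩⟩

instance : One (Heis n) := ⟨⟨0, 0⟩⟩

instance : Inv (Heis n) := ⟨fun p => ⟨-p.z, -p.t⟩⟩

@[simp] theorem mul_z (p q : Heis n) : (p * q).z = p.z + q.z := rfl

@[simp] theorem mul_t (p q : Heis n) :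
    (p * q).t = p.t + q.t + (1 / 2) * symp p.z q.z := rfl

@[simp] theorem one_z : (1 : Heis n).z = 0 := rfl

@[simp] theorem one_t : (1 : Heis n).t = 0 := rfl

@[simp] theorem inv_z (p : Heis n) : (p⁻¹).z = -p.z := rfl

@[simp] theorem inv_t (p : Heis n) : (p⁻¹).t = -p.t := rfl

theorem symp_add_left (a b c : EuclideanSpace ℝ (Fin n ⊕ Fin n)) :
    symp (a + b) c = symp a c + symp b c := by
  simp only [symp, ← Finset.sum_add_distrib, PiLp.add_apply]
  exact Finset.sum_congr rfl fun j _ => by ring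

theorem symp_add_right (a b c : EuclideanSpace ℝ (Fin n ⊕ Fin n)) :
    symp a (b + c) = symp a b + symp a c := by
  simp only [symp, ← Finset.sum_add_distrib, PiLp.add_apply]
  exact Finset.sum_congr rfl fun j _ => by ring

theorem symp_neg_self (a : EuclideanSpace ℝ (Fin n ⊕ Fin n)) : symp (-a) a = 0 := by
  simp only [symp, PiLp.neg_apply]
  exact Finset.sum_eq_zero fun j _ => by ring

noncomputable instance : Group (Heis n) :=
  Group.ofLeftAxioms
    (fun a b c => by
      ext1
      · simp [add_assoc]
      · simp only [mul_t, mul_z, symp_add_left, symp_add_right]; ring)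
    (fun a => by
      ext1
      · simp
      · simp [symp])
    (fun a => by
      ext1
      · simp
      · simp [symp_neg_self])

/-- The dilation `δ_λ (z, t) = (λ z, λ² t)`. -/
def dil (l : ℝ) (p : Heis n) : Heis n := ⟨l • p.z, l ^ 2 * p.t⟩

/-- The identification `ℍⁿ ≡ ℝ²ⁿ⁺¹`; the target carries its Euclidean norm and distance. -/
def toEuclidean (p : Heis n) : WithLp 2 (EuclideanSpace ℝ (Fin n ⊕ Fin n) × ℝ) :=
  WithLp.toLp 2 (p.z, p.t)

/-- A homogeneous distance: a distance function that is left-invariant and one-homogeneous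
with respect to dilations. -/
structure IsHomogeneousDistance (ρ : Heis n → Heis n → ℝ) : Prop where
  nonneg : ∀ p q, 0 ≤ ρ p q
  eq_zero_iff : ∀ p q, ρ p q = 0 ↔ p = q
  symm : ∀ p q, ρ p q = ρ q p
  triangle : ∀ p q r, ρ p r ≤ ρ p q + ρ q r
  left_invariant : ∀ g p q, ρ (g * p) (g * q) = ρ p q
  homogeneous : ∀ l : ℝ, 0 < l → ∀ p q, ρ (dil l p) (dil l q) = l * ρ p q

/-- `ρ(0, (z, t))` depends on `z = (x, y)` only through its Euclidean norm. -/
def IsRotationallyInvariant (ρ : Heis n → Heis n → ℝ) : Prop :=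
  ∀ (z z' : EuclideanSpace ℝ (Fin n ⊕ Fin n)) (t : ℝ), ‖z‖ = ‖z'‖ → ρ 1 ⟨z, t⟩ = ρ 1 ⟨z', t⟩

/-- Closed ball for the distance `ρ`. -/
def cBall (ρ : Heis n → Heis n → ℝ) (p : Heis n) (r : ℝ) : Set (Heis n) := {q | ρ p q ≤ r}

/-- The spherical Hausdorff (outer) measure of dimension `d` of the distance `ρ`, without
normalization constants. The centers of the covering balls are arbitrary points of `ℍⁿ`. The limit
as `ε → 0⁺` is written as a supremum, the infimum being monotone in `ε`. -/
noncomputable def sphericalMeasure (ρ : Heis n → Heis n → ℝ) (d : ℝ) (E : Set (Heis n)) : ℝ≥0∞ :=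
  ⨆ (ε : ℝ) (_ : 0 < ε),
    ⨅ (x : ℕ → Heis n) (r : ℕ → ℝ) (_ : ∀ j, 0 ≤ r j ∧ 2 * r j < ε)
      (_ : E ⊆ ⋃ j, cBall ρ (x j) (r j)),
      ∑' j, ENNReal.ofReal (2 * r j) ^ d

/-- The Euclidean Hausdorff (outer) measure of integer dimension `d` on `ℍⁿ ≡ ℝ²ⁿ⁺¹`, with the usual
normalization (it is Lebesgue measure on `d`-dimensional planes). -/
noncomputable def euclideanMeasure (d : ℕ) (E : Set (Heis n)) : ℝ≥0∞ :=
  μHE[d] (toEuclidean '' E)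

/-- A subgroup is homogeneous if `δ_λ(P) = P` for every `λ > 0`. -/
def IsHomogeneousSubgroup (P : Subgroup (Heis n)) : Prop :=
  ∀ l : ℝ, 0 < l → dil l '' (P : Set (Heis n)) = P

/-- A homogeneous subgroup is vertical if it contains the second layer `V₂ = {(0, t)}`. -/
def IsVertical (P : Subgroup (Heis n)) : Prop :=
  IsHomogeneousSubgroup P ∧ ∀ t : ℝ, (⟨0, t⟩ : Heis n) ∈ P

/-- A vertical subgroup is a linear subspace of `ℝ²ⁿ⁺¹`, and its topological dimension is its linear
dimension (the dimension of its linear span). -/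
noncomputable def topDim (P : Subgroup (Heis n)) : ℕ :=
  Module.finrank ℝ (Submodule.span ℝ (toEuclidean '' (P : Set (Heis n))))

/-- Homogeneous morphisms `ℍⁿ → ℝᵏ`: group morphisms that commute with the dilations. -/
structure IsHomogeneousMorphism {k : ℕ} (L : Heis n → EuclideanSpace ℝ (Fin k)) : Prop where
  map_mul : ∀ p q, L (p * q) = L p + L q
  map_dil : ∀ l : ℝ, 0 < l → ∀ p, L (dil l p) = l • L p

/-- Two homogeneous subgroups `W`, `V` are complementary if `V ∩ W = {0}` and `ℍⁿ = W V`. -/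
def IsComplementary (W V : Subgroup (Heis n)) : Prop :=
  IsHomogeneousSubgroup W ∧ IsHomogeneousSubgroup V ∧ V ⊓ W = ⊥ ∧
    ∀ g : Heis n, ∃ w ∈ W, ∃ v ∈ V, w * v = g

/-- The tangent subgroups `𝒯_{ℍⁿ, ℝᵏ}`: the normal subgroups that admit a complementary subgroup and
are the kernel of a surjective homogeneous morphism `ℍⁿ → ℝᵏ`. -/
def tangentSubgroups (n k : ℕ) : Set (Subgroup (Heis n)) :=
  {P | P.Normal ∧ (∃ V : Subgroup (Heis n), IsComplementary P V) ∧
    ∃ L : Heis n → EuclideanSpace ℝ (Fin k), IsHomogeneousMorphism L ∧ Function.Surjective L ∧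
      ∀ p, p ∈ P ↔ L p = 0}

end Heis

/-! A vertical subgroup is `P = W × ℝ` with `W` a linear subspace of `ℝ²ⁿ` of dimension `m = 2n -
k`, and the Euclidean measure on `P` is Lebesgue measure `μ` on `ℝᵐ × ℝ`. The left translation
taking `p` to `0` is, on `P`, a horizontal translation combined with a shear in `t`, which preserves
volume. By rotational invariance and Pythagoras, `μ (B(p, r))` then depends only on `r` and on the
distance from `p.z` to `W` (`volume_ball_eq_volume_ballSection`), and dilations produce the power `r
^ (m + 2)`.

Hence `μ (B(p, r)) ≤ β (2r) ^ (m + 2)` with `β = maxSection ρ m / 2 ^ (m + 2)`, a supremum over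
distances that depends on `W` only through `m`. Subadditivity gives `μ ≤ β 𝒮`. Conversely, near each
point of `P` and at each scale some ball, possibly centred off `P`, almost attains `β`; a Vitali
covering by such balls gives `β 𝒮 ≤ μ` (`mul_iSup_ballPremeasure_eq`). Outer approximation by open
sets makes this work for arbitrary sets. -/

namespace MeasureTheory

open Metric Set

/-! ### Spherical measures and density of balls in a metric space. -/

section BallPremeasure

variable {X : Type*} [MetricSpace X]

/-- The infimum of `∑ (2 r_j) ^ d` over the countable covers of `A` by closed balls of
diameter bound `2 r_j < ε`. -/
noncomputable def ballPremeasure (d ε : ℝ) (A : Set X) : ℝ≥0∞ :=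
  ⨅ (x : ℕ → X) (r : ℕ → ℝ) (_ : ∀ j, 0 ≤ r j ∧ 2 * r j < ε)
    (_ : A ⊆ ⋃ j, closedBall (x j) (r j)), ∑' j, ENNReal.ofReal (2 * r j) ^ d

theorem ballPremeasure_le_tsum [Nonempty X] {ι : Type*} [Countable ι] {d ε : ℝ} (hd : 0 < d)
    (hε : 0 < ε) {A : Set X} (x : ι → X) (r : ι → ℝ) (hr : ∀ i, 0 ≤ r i ∧ 2 * r i < ε)
    (hA : A ⊆ ⋃ i, closedBall (x i) (r i)) :
    ballPremeasure d ε A ≤ ∑' i, ENNReal.ofReal (2 * r i) ^ d := by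
  obtain ⟨f, hf⟩ := exists_injective_nat ι
  obtain ⟨x₀⟩ := ‹Nonempty X›
  have hsum : ∑' j, ENNReal.ofReal (2 * Function.extend f r 0 j) ^ d =
      ∑' i, ENNReal.ofReal (2 * r i) ^ d := by
    rw [← tsum_extend_zero hf]
    refine tsum_congr fun j => ?_
    by_cases hj : ∃ i, f i = j
    · obtain ⟨i, rfl⟩ := hj
      simp [hf.extend_apply]
    · simp [Function.extend_apply' _ _ _ hj, hd]
  rw [← hsum]
  -- Unused indices get balls of radius `0`, which cost `0 ^ d = 0` because `d > 0`.
  refine iInf_le_of_le (Function.extend f x fun _ => x₀) <|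
    iInf_le_of_le (Function.extend f r 0) <| iInf_le_of_le ?_ <| iInf_le_of_le ?_ le_rfl
  · intro j
    by_cases hj : ∃ i, f i = j
    · obtain ⟨i, rfl⟩ := hj
      simpa [hf.extend_apply] using hr i
    · simpa [Function.extend_apply' _ _ _ hj] using hε
  · refine hA.trans (iUnion_subset fun i => ?_)
    refine subset_iUnion_of_subset (f i) ?_
    simp [hf.extend_apply]

theorem ballPremeasure_union_le [Nonempty X] {d ε : ℝ} (hd : 0 < d) (hε : 0 < ε) (A B : Set X) :
    ballPremeasure d ε (A ∪ B) ≤ ballPremeasure d ε A + ballPremeasure d ε B := by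
  conv_rhs => rw [ballPremeasure, ballPremeasure]
  simp only [ENNReal.iInf_add, ENNReal.add_iInf]
  refine le_iInf fun y => le_iInf fun s => le_iInf fun hs => le_iInf fun hB => le_iInf fun x =>
    le_iInf fun r => le_iInf fun hr => le_iInf fun hA => ?_
  refine (ballPremeasure_le_tsum hd hε (Sum.elim x y) (Sum.elim r s) ?_ ?_).trans_eq ?_
  · rintro (i | i)
    exacts [hr i, hs i]
  · rw [iUnion_sum]
    exact union_subset_union hA hB
  · exact Summable.tsum_sum ENNReal.summable ENNReal.summable

theorem ballPremeasure_mono {d ε : ℝ} {A B : Set X} (h : A ⊆ B) :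
    ballPremeasure d ε A ≤ ballPremeasure d ε B :=
  le_iInf fun x => le_iInf fun r => le_iInf fun hr => le_iInf fun hB =>
    iInf_le_of_le x <| iInf_le_of_le r <| iInf_le_of_le hr <| iInf_le_of_le (h.trans hB) le_rfl

theorem measure_le_mul_ballPremeasure [MeasurableSpace X] {μ : Measure X} {d ε : ℝ}
    {β : ℝ≥0∞} (hβ0 : β ≠ 0) (hβ : β ≠ ∞)
    (hupper : ∀ p r, 0 < r → μ (closedBall p r) ≤ β * ENNReal.ofReal (2 * r) ^ d) (A : Set X) :
    μ A ≤ β * ballPremeasure d ε A := by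
  have hupper' : ∀ p r, 0 ≤ r → μ (closedBall p r) ≤ β * ENNReal.ofReal (2 * r) ^ d := by
    intro p r hr
    rcases hr.lt_or_eq with hr | rfl
    · exact hupper p r hr
    -- Covers may contain balls of radius `0`; the bound passes to them as `s → 0⁺`.
    have hlim : Filter.Tendsto (fun s : ℝ => β * ENNReal.ofReal (2 * s) ^ d)
        (nhdsWithin 0 (Ioi 0)) (nhds (β * ENNReal.ofReal (2 * 0) ^ d)) := by
      refine ENNReal.Tendsto.const_mul ?_ (Or.inr hβ)
      refine Filter.Tendsto.ennrpow_const d (Filter.Tendsto.mono_left ?_ nhdsWithin_le_nhds)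
      exact ((ENNReal.continuous_ofReal.comp (continuous_const.mul continuous_id)).tendsto 0)
    refine ge_of_tendsto hlim ?_
    filter_upwards [self_mem_nhdsWithin] with s hs
    exact (measure_mono (closedBall_subset_closedBall (le_of_lt hs))).trans (hupper p s hs)
  rw [mul_comm, ← ENNReal.div_le_iff hβ0 hβ]
  refine le_iInf fun x => le_iInf fun r => le_iInf fun hr => le_iInf fun hA => ?_
  rw [ENNReal.div_le_iff hβ0 hβ, mul_comm, ← ENNReal.tsum_mul_left]
  exact (measure_mono hA).trans <| (measure_iUnion_le _).trans <|
    ENNReal.tsum_le_tsum fun j => hupper' _ _ (hr j).1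

variable [MeasurableSpace X] [BorelSpace X] [SecondCountableTopology X]
  {μ : Measure X} [IsLocallyFiniteMeasure μ]

/-- Disjoint balls centred in `N` inside an open set of measure at most `δ` have `η ∑ (2r) ^ d ≤ δ`,
and by Vitali their 4-fold enlargements cover `N`. -/
theorem ballPremeasure_eq_zero_of_measure_eq_zero [Nonempty X] {d ε : ℝ} (hd : 0 < d) (hε : 0 < ε)
    {η : ℝ≥0∞} (hη0 : η ≠ 0) {N : Set X} (hN : μ N = 0)
    (hlower : ∀ x ∈ N, ∀ r, 0 < r → η * ENNReal.ofReal (2 * r) ^ d ≤ μ (closedBall x r)) :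
    ballPremeasure d ε N = 0 := by
  have key : ∀ δ : ℝ≥0∞, δ ≠ 0 → η * ballPremeasure d ε N ≤ ENNReal.ofReal 4 ^ d * δ := by
    intro δ hδ
    obtain ⟨U, hNU, hUo, hU⟩ := N.exists_isOpen_le_add μ hδ
    rw [hN, zero_add] at hU
    let t : Set (X × ℝ) := {a | a.1 ∈ N ∧ 0 < a.2 ∧ 2 * (4 * a.2) < ε ∧ closedBall a.1 a.2 ⊆ U}
    obtain ⟨u, hut, hudisj, hucov⟩ :=
      Vitali.exists_disjoint_subfamily_covering_enlargement_closedBall t Prod.fst Prod.snd ε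
        (fun a ha => by obtain ⟨_, h1, h2, _⟩ := ha; linarith) 4 (by norm_num)
    have hucount : u.Countable :=
      hudisj.countable_of_nonempty_interior fun a ha =>
        ⟨a.1, ball_subset_interior_closedBall (mem_ball_self (hut ha).2.1)⟩
    have : Countable u := hucount.to_subtype
    have hcov : N ⊆ ⋃ a : u, closedBall a.1.1 (4 * a.1.2) := by
      intro x hx
      obtain ⟨s, hs, hsU⟩ := nhds_basis_closedBall.mem_iff.1 (hUo.mem_nhds (hNU hx))
      have hmem : (x, min s (ε / 16)) ∈ t := by
        refine ⟨hx, lt_min hs (by positivity), ?_, ?_⟩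
        · have := min_le_right s (ε / 16)
          dsimp only
          linarith
        · exact (closedBall_subset_closedBall (min_le_left _ _)).trans hsU
      obtain ⟨b, hb, hsub⟩ := hucov _ hmem
      exact mem_iUnion.2 ⟨⟨b, hb⟩, hsub (mem_closedBall_self hmem.2.1.le)⟩
    calc η * ballPremeasure d ε N
        ≤ η * ∑' a : u, ENNReal.ofReal (2 * (4 * a.1.2)) ^ d := by
          gcongr
          exact ballPremeasure_le_tsum hd hε _ _
            (fun a => ⟨by have := (hut a.2).2.1; positivity, (hut a.2).2.2.1⟩) hcov
      _ = ENNReal.ofReal 4 ^ d * ∑' a : u, η * ENNReal.ofReal (2 * a.1.2) ^ d := by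
          rw [← ENNReal.tsum_mul_left, ← ENNReal.tsum_mul_left]
          refine tsum_congr fun a => ?_
          rw [mul_left_comm (ENNReal.ofReal 4 ^ d), ← ENNReal.mul_rpow_of_nonneg _ _ hd.le,
            ← ENNReal.ofReal_mul (by norm_num)]
          ring_nf
      _ ≤ ENNReal.ofReal 4 ^ d * ∑' a : u, μ (closedBall a.1.1 a.1.2) := by
          gcongr with a
          exact hlower _ (hut a.2).1 _ (hut a.2).2.1
      _ = ENNReal.ofReal 4 ^ d * μ (⋃ a ∈ u, closedBall a.1 a.2) := by
          rw [measure_biUnion hucount hudisj fun _ _ => measurableSet_closedBall]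
      _ ≤ ENNReal.ofReal 4 ^ d * δ := by
          gcongr
          exact (measure_mono (iUnion₂_subset fun a ha => (hut ha).2.2.2)).trans hU
  have hC0 : ENNReal.ofReal 4 ^ d ≠ 0 := by simp
  have hC : ENNReal.ofReal 4 ^ d ≠ ∞ := by simp
  have hzero : η * ballPremeasure d ε N = 0 := by
    by_contra hne
    rcases eq_or_ne (η * ballPremeasure d ε N) ∞ with htop | htop
    · have := key 1 one_ne_zero
      rw [htop, mul_one] at this
      exact hC (top_le_iff.1 this)
    · have := key (η * ballPremeasure d ε N / 2 / ENNReal.ofReal 4 ^ d)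
        (ENNReal.div_ne_zero.2 ⟨(ENNReal.half_pos hne).ne', hC⟩)
      rw [ENNReal.mul_div_cancel hC0 hC] at this
      exact absurd this (not_le.2 (ENNReal.half_lt_self hne htop))
  exact (mul_eq_zero.1 hzero).resolve_left hη0

/-- If every ball satisfies `μ (B(p, r)) ≤ β (2r)^d`, and near every point of `A` and at every scale
there are balls that almost attain the constant `β`, then `μ` agrees on `A` with `β` times the
spherical measure of dimension `d`. -/
theorem mul_iSup_ballPremeasure_eq [Nonempty X] {d : ℝ} (hd : 0 < d)
    {β : ℝ≥0∞} (hβ0 : β ≠ 0) (hβ : β ≠ ∞) {A : Set X}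
    (hupper : ∀ p r, 0 < r → μ (closedBall p r) ≤ β * ENNReal.ofReal (2 * r) ^ d)
    (hlower : ∀ η < β, ∃ R : ℝ, ∀ x ∈ A, ∀ r, 0 < r → ∃ p, dist p x ≤ R * r ∧
      η * ENNReal.ofReal (2 * r) ^ d ≤ μ (closedBall p r)) :
    β * ⨆ (ε : ℝ) (_ : 0 < ε), ballPremeasure d ε A = μ A := by
  refine le_antisymm ?_ ((measure_le_mul_ballPremeasure hβ0 hβ hupper A).trans
    (by gcongr; exact le_iSup₂_of_le 1 one_pos le_rfl))
  simp only [ENNReal.mul_iSup]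
  refine iSup₂_le fun ε hε => ?_
  refine ENNReal.mul_le_of_forall_lt fun η hη b hb => le_trans (mul_le_mul_right hb.le η) ?_
  clear b hb
  rcases eq_or_ne η 0 with rfl | hη0
  · simp
  have hηtop : η ≠ ∞ := hη.ne_top
  obtain ⟨R₀, hR₀⟩ := hlower η hη
  -- The `+ 1` absorbs the radius, so that `B(c x r, r) ⊆ B(x, R r)`.
  set R : ℝ := max R₀ 0 + 1 with hRdef
  have hRpos : 0 < R := by positivity
  choose! c hcdist hcμ using hR₀
  have hcball : ∀ x ∈ A, ∀ r, 0 < r → closedBall (c x r) r ⊆ closedBall x (R * r) := by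
    intro x hx r hr
    refine closedBall_subset_closedBall' ?_
    have h1 := hcdist x hx r hr
    have h2 := mul_le_mul_of_nonneg_right (le_max_left R₀ 0) hr.le
    rw [hRdef, add_mul]
    linarith
  refine ENNReal.le_of_forall_pos_le_add fun δ hδ _ => ?_
  obtain ⟨U, hAU, hUo, hU⟩ := A.exists_isOpen_le_add μ (ENNReal.coe_ne_zero.2 hδ.ne')
  refine le_trans ?_ hU
  let t : Set (X × ℝ) :=
    {a | a.1 ∈ A ∧ 0 < a.2 ∧ 2 * a.2 < ε ∧ closedBall (c a.1 a.2) a.2 ⊆ U}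
  -- The doubling condition of Vitali's theorem: the upper bound controls the large ball,
  -- near-extremality the small one.
  have hC : ∃ C : ℝ≥0, ∀ x ∈ A, ∀ r, 0 < r →
      μ (closedBall x (3 * (R * r))) ≤ C * μ (closedBall (c x r) r) := by
    refine ⟨(β * ENNReal.ofReal (3 * R) ^ d / η).toNNReal, fun x hx r hr => ?_⟩
    rw [ENNReal.coe_toNNReal (by finiteness)]
    calc μ (closedBall x (3 * (R * r)))
        ≤ β * ENNReal.ofReal (2 * (3 * (R * r))) ^ d := hupper _ _ (by positivity)
      _ = β * ENNReal.ofReal (3 * R) ^ d / η * (η * ENNReal.ofReal (2 * r) ^ d) := by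
          rw [← mul_assoc (_ / η), ENNReal.div_mul_cancel hη0 hηtop, mul_assoc β,
            ← ENNReal.mul_rpow_of_nonneg _ _ hd.le, ← ENNReal.ofReal_mul (by positivity)]
          ring_nf
      _ ≤ _ := by gcongr; exact hcμ x hx r hr
  obtain ⟨C, hC⟩ := hC
  -- The set attached to `x` is an off-centre ball that need not contain `x`.
  obtain ⟨u, hut, hucount, hudisj, hunull⟩ := Vitali.exists_disjoint_covering_ae μ A t C
    (fun a => R * a.2) Prod.fst (fun a => closedBall (c a.1 a.2) a.2)
    (fun a ha => hcball _ ha.1 _ ha.2.1) (fun a ha => hC _ ha.1 _ ha.2.1)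
    (fun a ha => ⟨_, ball_subset_interior_closedBall (mem_ball_self ha.2.1)⟩)
    (fun a ha => isClosed_closedBall) (by
      intro x hx s hs
      obtain ⟨s', hs', hsU⟩ := nhds_basis_closedBall.mem_iff.1 (hUo.mem_nhds (hAU hx))
      have hpos : 0 < min (min s s' / R) (ε / 4) := by positivity
      have hle : R * min (min s s' / R) (ε / 4) ≤ min s s' := by
        calc _ ≤ R * (min s s' / R) := by gcongr; exact min_le_left _ _
          _ = _ := by field_simp
      refine ⟨(x, min (min s s' / R) (ε / 4)), ⟨hx, hpos, ?_, ?_⟩, hle.trans (min_le_left _ _), rfl⟩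
      · have := min_le_right (min s s' / R) (ε / 4)
        dsimp only
        linarith
      · exact ((hcball x hx _ hpos).trans
          (closedBall_subset_closedBall (hle.trans (min_le_right _ _)))).trans hsU)
  have : Countable u := hucount.to_subtype
  -- The remainder is `μ`-null but must also be cheap to cover: `B(x, r)` contains a near-extremal
  -- ball of radius `R⁻¹ r`, giving the required lower density.
  have hnull : ballPremeasure d ε (A \ ⋃ a ∈ u, closedBall (c a.1 a.2) a.2) = 0 := by
    refine ballPremeasure_eq_zero_of_measure_eq_zero (μ := μ) hd hε
      (η := η * ENNReal.ofReal R⁻¹ ^ d) ?_ hunull ?_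
    · refine mul_ne_zero hη0 ?_
      simp [hRpos, ENNReal.rpow_eq_zero_iff]
    · intro x hx r hr
      have hr' : 0 < R⁻¹ * r := by positivity
      calc η * ENNReal.ofReal R⁻¹ ^ d * ENNReal.ofReal (2 * r) ^ d
          = η * ENNReal.ofReal (2 * (R⁻¹ * r)) ^ d := by
            rw [mul_assoc, ← ENNReal.mul_rpow_of_nonneg _ _ hd.le,
              ← ENNReal.ofReal_mul (by positivity)]
            ring_nf
        _ ≤ μ (closedBall (c x (R⁻¹ * r)) (R⁻¹ * r)) := hcμ x hx.1 _ hr'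
        _ ≤ μ (closedBall x r) := by
            refine measure_mono ((hcball x hx.1 _ hr').trans_eq ?_)
            rw [mul_inv_cancel_left₀ hRpos.ne']
  have hcov : ballPremeasure d ε (⋃ a ∈ u, closedBall (c a.1 a.2) a.2) ≤
      ∑' a : u, ENNReal.ofReal (2 * a.1.2) ^ d :=
    ballPremeasure_le_tsum hd hε (fun a : u => c a.1.1 a.1.2) (fun a => a.1.2)
      (fun a => ⟨(hut a.2).2.1.le, (hut a.2).2.2.1⟩) (by rw [biUnion_eq_iUnion])
  calc η * ballPremeasure d ε A
      ≤ η * ballPremeasure d ε ((A \ ⋃ a ∈ u, closedBall (c a.1 a.2) a.2) ∪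
          ⋃ a ∈ u, closedBall (c a.1 a.2) a.2) := by
        gcongr
        exact ballPremeasure_mono (by rw [sdiff_union_self]; exact subset_union_left)
    _ ≤ η * ∑' a : u, ENNReal.ofReal (2 * a.1.2) ^ d := by
        gcongr
        refine (ballPremeasure_union_le hd hε _ _).trans ?_
        rw [hnull, zero_add]
        exact hcov
    _ ≤ ∑' a : u, μ (closedBall (c a.1.1 a.1.2) a.1.2) := by
        rw [← ENNReal.tsum_mul_left]
        exact ENNReal.tsum_le_tsum fun a => hcμ _ (hut a.2).1 _ (hut a.2).2.1
    _ = μ (⋃ a ∈ u, closedBall (c a.1 a.2) a.2) := by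
        rw [measure_biUnion hucount hudisj fun _ _ => measurableSet_closedBall]
    _ ≤ μ U := measure_mono (iUnion₂_subset fun a ha => (hut ha).2.2.2)

end BallPremeasure

end MeasureTheory

namespace Heis

variable {n : ℕ} {ρ : Heis n → Heis n → ℝ}

/-! ### Algebra of the symplectic form. -/

theorem symp_smul_right (a b : EuclideanSpace ℝ (Fin n ⊕ Fin n)) (l : ℝ) :
    symp a (l • b) = l * symp a b := by
  simp only [symp, Finset.mul_sum, PiLp.smul_apply, smul_eq_mul]
  exact Finset.sum_congr rfl fun j _ => by ring

theorem symp_neg_left (a b : EuclideanSpace ℝ (Fin n ⊕ Fin n)) : symp (-a) b = -symp a b := by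
  simp only [symp, ← Finset.sum_neg_distrib, PiLp.neg_apply]
  exact Finset.sum_congr rfl fun j _ => by ring

@[simp] theorem symp_self (a : EuclideanSpace ℝ (Fin n ⊕ Fin n)) : symp a a = 0 := by
  simp [symp]

@[simp] theorem symp_zero_right (a : EuclideanSpace ℝ (Fin n ⊕ Fin n)) : symp a 0 = 0 := by
  simp [symp]

@[fun_prop]
theorem continuous_symp (a : EuclideanSpace ℝ (Fin n ⊕ Fin n)) : Continuous (symp a) := by
  unfold symp
  fun_prop

/-! ### Vertical subgroups as linear subspaces -/

theorem mk_mul_mk (z z' : EuclideanSpace ℝ (Fin n ⊕ Fin n)) (t t' : ℝ) :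
    (⟨z, t⟩ * ⟨z', t'⟩ : Heis n) = ⟨z + z', t + t' + 1 / 2 * symp z z'⟩ := rfl

theorem IsVertical.mem_of_z_eq {P : Subgroup (Heis n)} (hP : IsVertical P) {p q : Heis n}
    (hp : p ∈ P) (h : p.z = q.z) : q ∈ P := by
  have hq : q = p * ⟨0, q.t - p.t⟩ := by
    ext1
    · simp [h]
    · simp
  rw [hq]
  exact P.mul_mem hp (hP.2 _)

/-- Dilations supply positive scalars only; negative ones come from inverses. -/
theorem IsVertical.exists_submodule {P : Subgroup (Heis n)} (hP : IsVertical P) :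
    ∃ W : Submodule ℝ (EuclideanSpace ℝ (Fin n ⊕ Fin n)), ∀ p, p ∈ P ↔ p.z ∈ W := by
  have hpos : ∀ l : ℝ, 0 < l → ∀ z, (⟨z, 0⟩ : Heis n) ∈ P → (⟨l • z, 0⟩ : Heis n) ∈ P := by
    intro l hl z hz
    have h : dil l ⟨z, 0⟩ ∈ (P : Set (Heis n)) := hP.1 l hl ▸ Set.mem_image_of_mem _ hz
    exact hP.mem_of_z_eq h rfl
  refine ⟨{ carrier := {z | (⟨z, 0⟩ : Heis n) ∈ P}
            add_mem' := fun ha hb => hP.mem_of_z_eq (P.mul_mem ha hb) rfl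
            zero_mem' := P.one_mem
            smul_mem' := fun l z hz => ?_ }, fun p => ⟨fun hp => hP.mem_of_z_eq hp rfl,
              fun hp => hP.mem_of_z_eq hp rfl⟩⟩
  rcases lt_trichotomy l 0 with hl | rfl | hl
  · refine hP.mem_of_z_eq (P.inv_mem (hpos (-l) (by linarith) z hz)) ?_
    simp
  · exact hP.mem_of_z_eq P.one_mem (by simp)
  · exact hpos l hl z hz

theorem topDim_eq_finrank_add_one {P : Subgroup (Heis n)}
    {W : Submodule ℝ (EuclideanSpace ℝ (Fin n ⊕ Fin n))} (hW : ∀ p, p ∈ P ↔ p.z ∈ W) :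
    topDim P = Module.finrank ℝ W + 1 := by
  let f : (W × ℝ) →ₗ[ℝ] WithLp 2 (EuclideanSpace ℝ (Fin n ⊕ Fin n) × ℝ) :=
    (WithLp.linearEquiv 2 ℝ (EuclideanSpace ℝ (Fin n ⊕ Fin n) × ℝ)).symm.toLinearMap ∘ₗ
      W.subtype.prodMap LinearMap.id
  have hf : Function.Injective f :=
    (WithLp.linearEquiv 2 ℝ (EuclideanSpace ℝ (Fin n ⊕ Fin n) × ℝ)).symm.injective.comp
      (W.injective_subtype.prodMap Function.injective_id)
  have himage : toEuclidean '' (P : Set (Heis n)) = (LinearMap.range f : Set _) := by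
    ext x
    constructor
    · rintro ⟨p, hp, rfl⟩
      exact ⟨(⟨p.z, (hW p).1 hp⟩, p.t), rfl⟩
    · rintro ⟨⟨⟨z, hz⟩, t⟩, rfl⟩
      exact ⟨⟨z, t⟩, (hW _).2 hz, rfl⟩
  rw [topDim, himage, Submodule.span_eq, LinearMap.finrank_range_of_inj hf, Module.finrank_prod,
    Module.finrank_self]

/-- The dilation `δ₂` quadruples `t`, so homogeneity gives the factor 2 where additivity gives 4. -/
theorem IsHomogeneousMorphism.map_center {k : ℕ} {L : Heis n → EuclideanSpace ℝ (Fin k)}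
    (hL : IsHomogeneousMorphism L) (t : ℝ) : L ⟨0, t⟩ = 0 := by
  have h1 : L ⟨0, 4 * t⟩ = (2 : ℝ) • L ⟨0, t⟩ := by
    rw [← hL.map_dil 2 two_pos]
    simp only [dil, smul_zero]
    norm_num
  have h2 : ∀ s s' : ℝ, L ⟨0, s + s'⟩ = L ⟨0, s⟩ + L ⟨0, s'⟩ := fun s s' => by
    rw [← hL.map_mul, mk_mul_mk]
    simp
  have h3 : L ⟨0, 4 * t⟩ = (4 : ℝ) • L ⟨0, t⟩ := by
    rw [show 4 * t = (t + t) + (t + t) by ring, h2, h2]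
    module
  have h4 : (2 : ℝ) • L ⟨0, t⟩ = 0 := by
    have : (4 : ℝ) • L ⟨0, t⟩ - (2 : ℝ) • L ⟨0, t⟩ = 0 := by rw [← h3, h1, sub_self]
    rw [← this]
    module
  simpa using h4

theorem IsHomogeneousMorphism.exists_linearMap {k : ℕ} {L : Heis n → EuclideanSpace ℝ (Fin k)}
    (hL : IsHomogeneousMorphism L) :
    ∃ l : EuclideanSpace ℝ (Fin n ⊕ Fin n) →ₗ[ℝ] EuclideanSpace ℝ (Fin k),
      ∀ p, L p = l p.z := by
  have hz : ∀ p, L p = L ⟨p.z, 0⟩ := fun p => by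
    have hp : p = ⟨p.z, 0⟩ * ⟨0, p.t⟩ := by ext1 <;> simp
    conv_lhs => rw [hp, hL.map_mul, hL.map_center, add_zero]
  have hadd : ∀ a b, L ⟨a + b, 0⟩ = L ⟨a, 0⟩ + L ⟨b, 0⟩ := fun a b => by
    rw [← hL.map_mul, hz (_ * _)]
    rfl
  have hpos : ∀ c : ℝ, 0 < c → ∀ a, L ⟨c • a, 0⟩ = c • L ⟨a, 0⟩ := fun c hc a => by
    rw [← hL.map_dil c hc, hz (dil c _)]
    rfl
  have hneg : ∀ a, L ⟨-a, 0⟩ = -L ⟨a, 0⟩ := fun a => by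
    rw [eq_neg_iff_add_eq_zero, ← hadd, neg_add_cancel, hL.map_center]
  refine ⟨{ toFun := fun z => L ⟨z, 0⟩
            map_add' := hadd
            map_smul' := fun c a => ?_ }, hz⟩
  rw [RingHom.id_apply]
  rcases lt_trichotomy c 0 with hc | rfl | hc
  · have := hpos (-c) (by linarith) a
    rw [neg_smul, hneg, neg_smul] at this
    exact neg_injective this
  · rw [zero_smul, zero_smul, hL.map_center]
  · exact hpos c hc a

/-- Both descriptions of a vertical subgroup of codimension `k` lead to `P = W × ℝ` with a linear
subspace `W` of `ℝ²ⁿ` of codimension `k`. -/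
theorem exists_submodule_of_tangent_or_vertical {k : ℕ} (hkn : k ≤ n) {P : Subgroup (Heis n)}
    (hP : P ∈ tangentSubgroups n k ∨ (IsVertical P ∧ topDim P = 2 * n + 1 - k)) :
    ∃ W : Submodule ℝ (EuclideanSpace ℝ (Fin n ⊕ Fin n)),
      Module.finrank ℝ W = 2 * n - k ∧ ∀ p, p ∈ P ↔ p.z ∈ W := by
  rcases hP with ⟨-, -, L, hL, hsurj, hker⟩ | ⟨hvert, hdim⟩
  · obtain ⟨l, hl⟩ := hL.exists_linearMap
    refine ⟨LinearMap.ker l, ?_, fun p => by rw [hker, hl, LinearMap.mem_ker]⟩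
    have hrange : LinearMap.range l = ⊤ := by
      refine LinearMap.range_eq_top.2 fun y => ?_
      obtain ⟨p, rfl⟩ := hsurj y
      exact ⟨p.z, (hl p).symm⟩
    have h := l.finrank_range_add_finrank_ker
    rw [hrange, finrank_top, finrank_euclideanSpace, finrank_euclideanSpace] at h
    simp only [Fintype.card_sum, Fintype.card_fin] at h
    omega
  · obtain ⟨W, hW⟩ := hvert.exists_submodule
    refine ⟨W, ?_, hW⟩
    rw [topDim_eq_finrank_add_one hW] at hdim
    omega

/-! ### Comparison of a homogeneous distance with the Euclidean one -/

namespace IsHomogeneousDistance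

theorem eq_norm (hρ : IsHomogeneousDistance ρ) (p q : Heis n) :
    ρ p q = ρ 1 ⟨q.z - p.z, q.t - p.t - 1 / 2 * symp p.z q.z⟩ := by
  rw [← hρ.left_invariant p⁻¹ p q, inv_mul_cancel]
  congr 1
  ext1
  · simp only [mul_z, inv_z]; abel
  · simp only [mul_t, inv_t, inv_z, symp_neg_left]; ring

theorem norm_mul_le (hρ : IsHomogeneousDistance ρ) (p q : Heis n) :
    ρ 1 (p * q) ≤ ρ 1 p + ρ 1 q := by
  refine (hρ.triangle 1 p (p * q)).trans_eq ?_
  have := hρ.left_invariant p 1 q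
  rw [mul_one] at this
  rw [this]

theorem norm_inv (hρ : IsHomogeneousDistance ρ) (p : Heis n) : ρ 1 p⁻¹ = ρ 1 p := by
  have := hρ.left_invariant p 1 p⁻¹
  rw [mul_one, mul_inv_cancel, hρ.symm] at this
  exact this.symm

theorem norm_dil (hρ : IsHomogeneousDistance ρ) {l : ℝ} (hl : 0 < l) (p : Heis n) :
    ρ 1 (dil l p) = l * ρ 1 p := by
  rw [← hρ.homogeneous l hl]
  congr 1
  ext1 <;> simp [dil]

theorem norm_pos (hρ : IsHomogeneousDistance ρ) {p : Heis n} (hp : p ≠ 1) : 0 < ρ 1 p :=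
  lt_of_le_of_ne (hρ.nonneg _ _) fun h => hp ((hρ.eq_zero_iff _ _).1 h.symm).symm

theorem exists_horizontal_norm_eq (hρ : IsHomogeneousDistance ρ) (hrot : IsRotationallyInvariant ρ)
    (hn : 0 < n) : ∃ K : ℝ, 0 < K ∧ ∀ z, ρ 1 ⟨z, 0⟩ = K * ‖z‖ := by
  let e : EuclideanSpace ℝ (Fin n ⊕ Fin n) := EuclideanSpace.single (Sum.inl ⟨0, hn⟩) 1
  have he : ‖e‖ = 1 := by simp [e]
  refine ⟨ρ 1 ⟨e, 0⟩, hρ.norm_pos fun h => ?_, fun z => ?_⟩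
  · have h0 : e = 0 := congrArg Heis.z h
    rw [h0, norm_zero] at he
    exact zero_ne_one he
  · rcases eq_or_ne z 0 with rfl | hz
    · rw [norm_zero, mul_zero]
      exact (hρ.eq_zero_iff _ _).2 rfl
    · have hz' : 0 < ‖z‖ := norm_pos_iff.2 hz
      rw [mul_comm, ← hρ.norm_dil hz']
      simp only [dil, mul_zero]
      exact hrot _ _ _ (by rw [norm_smul, he, mul_one, norm_norm])

theorem exists_vertical_norm_eq (hρ : IsHomogeneousDistance ρ) :
    ∃ K : ℝ, 0 < K ∧ ∀ t, ρ 1 ⟨0, t⟩ = K * √|t| := by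
  have hpos : ∀ t : ℝ, 0 < t → ρ 1 ⟨0, t⟩ = ρ 1 ⟨0, 1⟩ * √|t| := fun t ht => by
    rw [mul_comm, ← hρ.norm_dil (Real.sqrt_pos.2 (abs_pos.2 ht.ne'))]
    simp [dil, abs_of_pos ht, ht.le]
  refine ⟨ρ 1 ⟨0, 1⟩, hρ.norm_pos fun h => one_ne_zero (congrArg Heis.t h), fun t => ?_⟩
  rcases lt_trichotomy t 0 with ht | rfl | ht
  · have h := hpos (-t) (by linarith)
    rw [abs_neg, ← hρ.norm_inv] at h
    rw [← h]
    congr 1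
    ext1 <;> simp
  · rw [abs_zero, Real.sqrt_zero, mul_zero]
    exact (hρ.eq_zero_iff _ _).2 rfl
  · exact hpos t ht

/-- A rotationally invariant homogeneous distance is equivalent to `‖z‖ + √|t|`. -/
theorem exists_norm_bounds (hρ : IsHomogeneousDistance ρ) (hrot : IsRotationallyInvariant ρ)
    (hn : 0 < n) : ∃ K₁ K₂ : ℝ, 0 < K₁ ∧ 0 < K₂ ∧
      ∀ z t, K₁ * ‖z‖ ≤ ρ 1 ⟨z, t⟩ ∧ K₂ * √|t| ≤ 2 * ρ 1 ⟨z, t⟩ ∧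
        ρ 1 ⟨z, t⟩ ≤ K₁ * ‖z‖ + K₂ * √|t| := by
  obtain ⟨K₁, hK₁, h₁⟩ := hρ.exists_horizontal_norm_eq hrot hn
  obtain ⟨K₂, hK₂, h₂⟩ := hρ.exists_vertical_norm_eq
  refine ⟨K₁, K₂, hK₁, hK₂, fun z t => ?_⟩
  -- Uses `(z, t)(z, -t) = (2z, 0)`; both factors have equal norm by inversion and rotational
  -- invariance.
  have hlow : K₁ * ‖z‖ ≤ ρ 1 ⟨z, t⟩ := by
    have hsymm : ρ 1 ⟨z, -t⟩ = ρ 1 ⟨z, t⟩ := by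
      rw [← hρ.norm_inv ⟨z, t⟩]
      exact hrot _ _ _ (norm_neg z).symm
    have h := hρ.norm_mul_le ⟨z, t⟩ ⟨z, -t⟩
    rw [hsymm, mk_mul_mk, symp_self, mul_zero, add_zero, add_neg_cancel, h₁, ← two_smul ℝ z,
      norm_smul, Real.norm_ofNat] at h
    linarith
  refine ⟨hlow, ?_, ?_⟩
  · have h := hρ.norm_mul_le ⟨z, t⟩ ⟨-z, 0⟩
    have hs : symp z (-z) = 0 := by rw [← neg_one_smul ℝ z, symp_smul_right, symp_self, mul_zero]
    rw [mk_mul_mk, hs, mul_zero, add_zero, add_zero, add_neg_cancel, h₁, h₂, norm_neg] at h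
    linarith
  · have h := hρ.norm_mul_le ⟨z, 0⟩ ⟨0, t⟩
    rwa [mk_mul_mk, symp_zero_right, mul_zero, add_zero, add_zero, zero_add, h₁, h₂] at h

/-- The metric space structure of a homogeneous distance. -/
abbrev metricSpace (hρ : IsHomogeneousDistance ρ) : MetricSpace (Heis n) where
  dist := ρ
  dist_self p := (hρ.eq_zero_iff p p).2 rfl
  dist_comm := hρ.symm
  dist_triangle := hρ.triangle
  eq_of_dist_eq_zero h := (hρ.eq_zero_iff _ _).1 h

/-- The topology of a rotationally invariant homogeneous distance is the Euclidean one. -/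
theorem exists_homeomorph_toEuclidean (hρ : IsHomogeneousDistance ρ)
    (hrot : IsRotationallyInvariant ρ) (hn : 0 < n) :
    letI := hρ.metricSpace
    ∃ e : Heis n ≃ₜ WithLp 2 (EuclideanSpace ℝ (Fin n ⊕ Fin n) × ℝ), ⇑e = toEuclidean := by
  let _ := hρ.metricSpace
  obtain ⟨K₁, K₂, hK₁, hK₂, hK⟩ := hρ.exists_norm_bounds hrot hn
  have hz : Continuous (Heis.z : Heis n → _) := by
    refine (LipschitzWith.of_dist_le' (K := K₁⁻¹) fun p q => ?_).continuous
    have h := (hK (q.z - p.z) (q.t - p.t - 1 / 2 * symp p.z q.z)).1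
    rw [← hρ.eq_norm] at h
    rw [dist_comm, dist_eq_norm, inv_mul_eq_div, le_div_iff₀' hK₁]
    exact h
  have ht : Continuous (Heis.t : Heis n → ℝ) := by
    rw [continuous_iff_continuousAt]
    intro p
    have hd : Filter.Tendsto (fun q => dist p q) (nhds p) (nhds 0) := by
      have : Continuous fun q => dist p q := by fun_prop
      simpa using this.tendsto p
    -- The distance controls `q.t - p.t` only up to the group correction, which vanishes in the
    -- limit since `symp p.z p.z = 0`.
    have h1 : Filter.Tendsto (fun q : Heis n => q.t - p.t - 1 / 2 * symp p.z q.z) (nhds p)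
        (nhds 0) := by
      refine squeeze_zero_norm (a := fun q => (2 * dist p q / K₂) ^ 2) (fun q => ?_) ?_
      · have h := (hK (q.z - p.z) (q.t - p.t - 1 / 2 * symp p.z q.z)).2.1
        rw [← hρ.eq_norm] at h
        have h' : √|q.t - p.t - 1 / 2 * symp p.z q.z| ≤ 2 * dist p q / K₂ := by
          rw [le_div_iff₀' hK₂]
          exact h
        rw [Real.norm_eq_abs]
        exact (Real.sqrt_le_left (by positivity)).1 h'
      · simpa using ((hd.const_mul 2).div_const K₂).pow 2
    have h2 : Filter.Tendsto (fun q : Heis n => p.t + 1 / 2 * symp p.z q.z) (nhds p)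
        (nhds p.t) := by
      have : Continuous fun q : Heis n => p.t + 1 / 2 * symp p.z q.z := by fun_prop
      simpa using this.tendsto p
    have h3 := h1.add h2
    rw [zero_add] at h3
    refine h3.congr fun q => ?_
    ring
  refine ⟨{ toFun := toEuclidean
            invFun := fun x => ⟨x.fst, x.snd⟩
            left_inv := fun _ => rfl
            right_inv := fun _ => rfl
            continuous_toFun := (WithLp.prod_continuous_toLp 2 _ _).comp (hz.prodMk ht)
            continuous_invFun := ?_ }, rfl⟩
  rw [continuous_iff_continuousAt]
  intro x
  rw [ContinuousAt, tendsto_iff_dist_tendsto_zero]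
  have hcont : Continuous fun y : WithLp 2 (EuclideanSpace ℝ (Fin n ⊕ Fin n) × ℝ) =>
      K₁ * ‖y.fst - x.fst‖ + K₂ * √|y.snd - x.snd - 1 / 2 * symp x.fst y.fst| := by
    fun_prop
  refine squeeze_zero (fun _ => dist_nonneg) (fun y => ?_) (hcont.tendsto' x 0 (by simp))
  rw [dist_comm]
  refine (hρ.eq_norm _ _).trans_le ?_
  exact (hK _ _).2.2

end IsHomogeneousDistance

end Heis

namespace Heis

variable {n : ℕ} {ρ : Heis n → Heis n → ℝ}

/-! ### Sections of balls by vertical subgroups -/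

/-- The points `(u, t) ∈ ℝᵐ × ℝ` with `ρ(0, (z, t)) ≤ r` for `‖z‖² = ‖u‖² + a²`: up to a
volume-preserving map, the section of a ball of radius `r` by a vertical subgroup of dimension
`m + 1` at horizontal distance `a` from its center. -/
def ballSection (ρ : Heis n → Heis n → ℝ) (m : ℕ) (a r : ℝ) :
    Set (EuclideanSpace ℝ (Fin m) × ℝ) :=
  {x | ∀ z : EuclideanSpace ℝ (Fin n ⊕ Fin n), ‖z‖ ^ 2 = ‖x.1‖ ^ 2 + a ^ 2 → ρ 1 ⟨z, x.2⟩ ≤ r}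

theorem mem_ballSection_iff (hrot : IsRotationallyInvariant ρ) {m : ℕ} {a r : ℝ}
    {x : EuclideanSpace ℝ (Fin m) × ℝ} {z : EuclideanSpace ℝ (Fin n ⊕ Fin n)}
    (hz : ‖z‖ ^ 2 = ‖x.1‖ ^ 2 + a ^ 2) : x ∈ ballSection ρ m a r ↔ ρ 1 ⟨z, x.2⟩ ≤ r := by
  refine ⟨fun h => h z hz, fun h z' hz' => ?_⟩
  rwa [hrot z' z x.2 ((sq_eq_sq₀ (norm_nonneg _) (norm_nonneg _)).1 (hz'.trans hz.symm))]

/-- The vertical direction counts twice, hence the homogeneous dimension `m + 2`. -/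
theorem volume_preimage_dilation {m : ℕ} {r : ℝ} (hr : 0 < r)
    (S : Set (EuclideanSpace ℝ (Fin m) × ℝ)) :
    volume ((fun x : EuclideanSpace ℝ (Fin m) × ℝ => (r⁻¹ • x.1, (r⁻¹) ^ 2 • x.2)) ⁻¹' S) =
      ENNReal.ofReal r ^ (m + 2) * volume S := by
  have hr' : r⁻¹ ≠ 0 := inv_ne_zero hr.ne'
  let e : (EuclideanSpace ℝ (Fin m) × ℝ) ≃ᵐ (EuclideanSpace ℝ (Fin m) × ℝ) :=
    MeasurableEquiv.prodCongr (MeasurableEquiv.smul₀ r⁻¹ hr')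
      (MeasurableEquiv.smul₀ (r⁻¹ ^ 2) (pow_ne_zero 2 hr'))
  have hmap : (volume : Measure (EuclideanSpace ℝ (Fin m) × ℝ)).map e =
      ENNReal.ofReal r ^ (m + 2) • volume := by
    change ((volume : Measure (EuclideanSpace ℝ (Fin m))).prod (volume : Measure ℝ)).map
      (Prod.map (r⁻¹ • ·) (r⁻¹ ^ 2 • ·)) = _
    rw [← Measure.map_prod_map _ _ (measurable_const_smul _) (measurable_const_smul _),
      Measure.map_addHaar_smul _ hr', Measure.map_addHaar_smul _ (pow_ne_zero 2 hr'),
      Measure.prod_smul_left, Measure.prod_smul_right, smul_smul, finrank_euclideanSpace,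
      Module.finrank_self, Fintype.card_fin, ← ENNReal.ofReal_mul (abs_nonneg _),
      ← ENNReal.ofReal_pow hr.le]
    congr 2
    simp [abs_of_pos hr, pow_add]
  have h := e.map_apply (μ := volume) S
  rw [hmap, Measure.smul_apply, smul_eq_mul] at h
  exact h.symm

theorem volume_ballSection_mul (hρ : IsHomogeneousDistance ρ) (m : ℕ) (a : ℝ) {r : ℝ}
    (hr : 0 < r) : volume (ballSection ρ m (r * a) r) =
      ENNReal.ofReal r ^ (m + 2) * volume (ballSection ρ m a 1) := by
  rw [← volume_preimage_dilation hr]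
  congr 1
  have hiff : ∀ z (t : ℝ), ρ 1 ⟨r • z, t⟩ ≤ r ↔ ρ 1 ⟨z, r⁻¹ ^ 2 * t⟩ ≤ 1 := fun z t => by
    have : (⟨r • z, t⟩ : Heis n) = dil r ⟨z, r⁻¹ ^ 2 * t⟩ := by
      ext1
      · rfl
      · simp only [dil]; field_simp
    rw [this, hρ.norm_dil hr, mul_le_iff_le_one_right hr]
  ext x
  constructor
  · intro hx z hz
    refine (hiff z x.2).1 (hx _ ?_)
    rw [norm_smul, mul_pow, hz, norm_smul, norm_inv, Real.norm_of_nonneg hr.le]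
    field_simp
  · intro hx z hz
    have := (hiff (r⁻¹ • z) x.2).2 (hx _ ?_)
    · rwa [smul_inv_smul₀ hr.ne'] at this
    · simp only [norm_smul, norm_inv, Real.norm_of_nonneg hr.le, mul_pow, hz]
      field_simp

theorem measurePreserving_shear {m : ℕ} (b : EuclideanSpace ℝ (Fin m))
    {g : EuclideanSpace ℝ (Fin m) → ℝ}
    (hg : Continuous g) :
    MeasurePreserving (fun x : EuclideanSpace ℝ (Fin m) × ℝ => (x.1 - b, x.2 + g x.1)) ∧
      MeasurableEmbedding (fun x : EuclideanSpace ℝ (Fin m) × ℝ => (x.1 - b, x.2 + g x.1)) := by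
  constructor
  · refine MeasurePreserving.skew_product (g := fun u t => t + g u)
      (measurePreserving_sub_right volume b) (by fun_prop) (Filter.Eventually.of_forall fun u => ?_)
    exact map_add_right_eq_self _ _
  · let e : (EuclideanSpace ℝ (Fin m) × ℝ) ≃ₜ (EuclideanSpace ℝ (Fin m) × ℝ) :=
      { toFun := fun x => (x.1 - b, x.2 + g x.1)
        invFun := fun x => (x.1 + b, x.2 - g (x.1 + b))
        left_inv := fun x => by simp
        right_inv := fun x => by simp
        continuous_toFun := by fun_prop
        continuous_invFun := by fun_prop }
    exact e.measurableEmbedding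

/-- Here `i b` is the orthogonal projection of `p.z` to the range of `i`; Pythagoras leaves only its
distance to `p.z`, and a shear absorbs the group law. -/
theorem volume_ball_eq_volume_ballSection (hρ : IsHomogeneousDistance ρ)
    (hrot : IsRotationallyInvariant ρ) {m : ℕ}
    (i : EuclideanSpace ℝ (Fin m) →ₗᵢ[ℝ] EuclideanSpace ℝ (Fin n ⊕ Fin n)) (p : Heis n)
    (b : EuclideanSpace ℝ (Fin m)) (hb : ∀ u, inner ℝ (i u) (p.z - i b) = 0) (r : ℝ) :
    volume {x : EuclideanSpace ℝ (Fin m) × ℝ | ρ p ⟨i x.1, x.2⟩ ≤ r} =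
      volume (ballSection ρ m ‖p.z - i b‖ r) := by
  obtain ⟨hmp, hemb⟩ := measurePreserving_shear b (g := fun u => -p.t - 1 / 2 * symp p.z (i u))
    (by have := i.continuous; fun_prop)
  rw [← hmp.measure_preimage_emb hemb (ballSection ρ m ‖p.z - i b‖ r)]
  congr 1
  ext x
  have hnorm : ‖i x.1 - p.z‖ ^ 2 = ‖x.1 - b‖ ^ 2 + ‖p.z - i b‖ ^ 2 := by
    have h : i x.1 - p.z = i (x.1 - b) - (p.z - i b) := by rw [map_sub]; abel
    rw [h, @norm_sub_sq_real, hb, i.norm_map]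
    ring
  rw [Set.mem_preimage, mem_ballSection_iff (x := (_, _)) hrot hnorm, Set.mem_ofPred_eq, hρ.eq_norm]
  simp only [add_sub, ← sub_eq_add_neg]

theorem ballSection_subset (hρ : IsHomogeneousDistance ρ) (hrot : IsRotationallyInvariant ρ)
    (hn : 0 < n) (m : ℕ) : ∃ s T : ℝ, ∀ a, ballSection ρ m a 1 ⊆
      Metric.closedBall 0 s ×ˢ Metric.closedBall 0 T := by
  obtain ⟨K₁, K₂, hK₁, hK₂, hK⟩ := hρ.exists_norm_bounds hrot hn
  refine ⟨1 / K₁, (2 / K₂) ^ 2, fun a x hx => ?_⟩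
  -- A vector `z` of the prescribed norm must exist, or the condition defining the section would be
  -- vacuous.
  have : Nonempty (Fin n) := ⟨⟨0, hn⟩⟩
  obtain ⟨z, hz⟩ := exists_norm_eq (EuclideanSpace ℝ (Fin n ⊕ Fin n))
    (Real.sqrt_nonneg (‖x.1‖ ^ 2 + a ^ 2))
  have hz2 : ‖z‖ ^ 2 = ‖x.1‖ ^ 2 + a ^ 2 := by rw [hz, Real.sq_sqrt (by positivity)]
  have hx1 := (mem_ballSection_iff hrot hz2).1 hx
  obtain ⟨h1, h2, -⟩ := hK z x.2
  have hle : ‖x.1‖ ≤ ‖z‖ := by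
    refine (sq_le_sq₀ (norm_nonneg _) (norm_nonneg _)).1 ?_
    rw [hz2]
    linarith [sq_nonneg a]
  refine ⟨mem_closedBall_zero_iff.2 ?_, mem_closedBall_zero_iff.2 ?_⟩
  · rw [le_div_iff₀' hK₁]
    exact (mul_le_mul_of_nonneg_left hle hK₁.le).trans (h1.trans hx1)
  · rw [Real.norm_eq_abs]
    refine (Real.sqrt_le_left (by positivity)).1 ?_
    rw [le_div_iff₀' hK₂]
    linarith

theorem subset_ballSection (hρ : IsHomogeneousDistance ρ) (hrot : IsRotationallyInvariant ρ)
    (hn : 0 < n) (m : ℕ) : ∃ s T : ℝ, 0 < s ∧ 0 < T ∧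
      Metric.closedBall 0 s ×ˢ Metric.closedBall 0 T ⊆ ballSection ρ m 0 1 := by
  obtain ⟨K₁, K₂, hK₁, hK₂, hK⟩ := hρ.exists_norm_bounds hrot hn
  refine ⟨1 / 2 / K₁, (1 / 2 / K₂) ^ 2, by positivity, by positivity, ?_⟩
  rintro x ⟨hx1, hx2⟩ z hz
  rw [mem_closedBall_zero_iff] at hx1 hx2
  have hzx : ‖z‖ = ‖x.1‖ := by
    refine (sq_eq_sq₀ (norm_nonneg _) (norm_nonneg _)).1 ?_
    rw [hz]
    ring
  have h1 : K₁ * ‖z‖ ≤ 1 / 2 := by rwa [hzx, ← le_div_iff₀' hK₁]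
  have h2 : K₂ * √|x.2| ≤ 1 / 2 := by
    rw [← le_div_iff₀' hK₂]
    exact (Real.sqrt_le_left (by positivity)).2 hx2
  linarith [(hK z x.2).2.2]

/-- The supremum of the volumes of the sections of unit balls by vertical subgroups of
dimension `m + 1`. -/
noncomputable def maxSection (ρ : Heis n → Heis n → ℝ) (m : ℕ) : ℝ≥0∞ :=
  ⨆ a : ℝ, volume (ballSection ρ m a 1)

theorem maxSection_ne_top (hρ : IsHomogeneousDistance ρ) (hrot : IsRotationallyInvariant ρ)
    (hn : 0 < n) (m : ℕ) : maxSection ρ m ≠ ∞ := by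
  obtain ⟨s, T, h⟩ := ballSection_subset hρ hrot hn m
  refine ne_top_of_le_ne_top ?_ (iSup_le fun a => measure_mono (h a))
  exact ((isCompact_closedBall _ _).prod (isCompact_closedBall _ _)).measure_ne_top

theorem maxSection_ne_zero (hρ : IsHomogeneousDistance ρ) (hrot : IsRotationallyInvariant ρ)
    (hn : 0 < n) (m : ℕ) : maxSection ρ m ≠ 0 := by
  obtain ⟨s, T, hs, hT, h⟩ := subset_ballSection hρ hrot hn m
  refine (lt_of_lt_of_le ?_ ((measure_mono h).trans (le_iSup (fun a : ℝ =>
    volume (ballSection ρ m a 1)) 0))).ne'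
  change 0 < (Measure.prod volume volume) _
  rw [Measure.prod_prod]
  exact ENNReal.mul_pos (Metric.measure_closedBall_pos _ _ hs).ne'
    (Metric.measure_closedBall_pos _ _ hT).ne'

/-- The Euclidean Hausdorff measure on a vertical subgroup is the Lebesgue measure of a linear
isometric parametrization. -/
theorem euclideanMeasure_inter_eq_volume {P : Subgroup (Heis n)} {m : ℕ}
    (i : EuclideanSpace ℝ (Fin m) →ₗᵢ[ℝ] EuclideanSpace ℝ (Fin n ⊕ Fin n))
    (hP : ∀ p, p ∈ P ↔ p.z ∈ Set.range i) (S : Set (Heis n)) :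
    euclideanMeasure (m + 1) (S ∩ P) =
      volume {x : EuclideanSpace ℝ (Fin m) × ℝ | (⟨i x.1, x.2⟩ : Heis n) ∈ S} := by
  let J : WithLp 2 (EuclideanSpace ℝ (Fin m) × ℝ) →
      WithLp 2 (EuclideanSpace ℝ (Fin n ⊕ Fin n) × ℝ) := fun x => WithLp.toLp 2 (i x.fst, x.snd)
  have hJ : Isometry J := Isometry.of_dist_eq fun x y => by
    simp [J, WithLp.prod_dist_eq_of_L2, i.isometry.dist_eq]
  have himage : toEuclidean '' (S ∩ P) = J '' (WithLp.ofLp ⁻¹'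
      {x : EuclideanSpace ℝ (Fin m) × ℝ | (⟨i x.1, x.2⟩ : Heis n) ∈ S}) := by
    ext y
    constructor
    · rintro ⟨⟨z, t⟩, ⟨hpS, hpP⟩, rfl⟩
      obtain ⟨u, rfl⟩ := (hP _).1 hpP
      exact ⟨WithLp.toLp 2 (u, t), hpS, rfl⟩
    · rintro ⟨x, hx, rfl⟩
      exact ⟨⟨i x.fst, x.snd⟩, ⟨hx, (hP _).2 ⟨_, rfl⟩⟩, rfl⟩
  have hdim : Module.finrank ℝ (WithLp 2 (EuclideanSpace ℝ (Fin m) × ℝ)) = m + 1 := by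
    rw [(WithLp.linearEquiv 2 ℝ (EuclideanSpace ℝ (Fin m) × ℝ)).finrank_eq, Module.finrank_prod,
      finrank_euclideanSpace, Fintype.card_fin, Module.finrank_self]
  rw [euclideanMeasure, himage, hJ.euclideanHausdorffMeasure_image, ← hdim,
    InnerProductSpace.euclideanHausdorffMeasure_eq_volume]
  exact (WithLp.volume_preserving_symm_measurableEquiv_toLp_prod
    (EuclideanSpace ℝ (Fin m)) ℝ).measure_preimage_equiv _

end Heis

namespace Heis

variable {n : ℕ} {ρ : Heis n → Heis n → ℝ}

/-! ### Comparison of the two measures on a vertical subgroup. -/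

theorem sphericalMeasure_eq_iSup_ballPremeasure (hρ : IsHomogeneousDistance ρ) (d : ℝ)
    (E : Set (Heis n)) : letI := hρ.metricSpace
    sphericalMeasure ρ d E = ⨆ (ε : ℝ) (_ : 0 < ε), ballPremeasure d ε E := by
  let _ := hρ.metricSpace
  have hball : ∀ p r, cBall ρ p r = Metric.closedBall p r := fun p r => by
    ext q
    rw [Metric.mem_closedBall, dist_comm]
    rfl
  simp only [sphericalMeasure, ballPremeasure, hball]

theorem euclideanMeasure_cBall_inter (hρ : IsHomogeneousDistance ρ)
    (hrot : IsRotationallyInvariant ρ) {P : Subgroup (Heis n)} {m : ℕ}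
    (i : EuclideanSpace ℝ (Fin m) →ₗᵢ[ℝ] EuclideanSpace ℝ (Fin n ⊕ Fin n))
    (hP : ∀ p, p ∈ P ↔ p.z ∈ Set.range i) (p : Heis n)
    {b : EuclideanSpace ℝ (Fin m)} (hb : ∀ u, inner ℝ (i u) (p.z - i b) = 0) {r : ℝ} (hr : 0 < r) :
    euclideanMeasure (m + 1) (cBall ρ p r ∩ P) =
      ENNReal.ofReal r ^ (m + 2) * volume (ballSection ρ m (r⁻¹ * ‖p.z - i b‖) 1) := by
  rw [euclideanMeasure_inter_eq_volume i hP, ← volume_ballSection_mul hρ m _ hr,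
    mul_inv_cancel_left₀ hr.ne']
  exact volume_ball_eq_volume_ballSection hρ hrot i p b hb r

theorem exists_forall_inner_sub_eq_zero {m : ℕ}
    (i : EuclideanSpace ℝ (Fin m) →ₗᵢ[ℝ] EuclideanSpace ℝ (Fin n ⊕ Fin n))
    (z : EuclideanSpace ℝ (Fin n ⊕ Fin n)) : ∃ b, ∀ u, inner ℝ (i u) (z - i b) = 0 := by
  let W := LinearMap.range i.toLinearMap
  obtain ⟨b, hb⟩ : W.starProjection z ∈ W := W.starProjection_apply_mem z
  refine ⟨b, fun u => ?_⟩
  have h := W.sub_starProjection_mem_orthogonal z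
  rw [← hb] at h
  exact (Submodule.mem_orthogonal _ _).1 h _ ⟨u, rfl⟩

/-- Positive codimension leaves a normal direction, along which centres can be moved to any distance
from the subgroup. -/
theorem exists_unit_forall_inner_eq_zero {m : ℕ} (hm : m < 2 * n)
    (i : EuclideanSpace ℝ (Fin m) →ₗᵢ[ℝ] EuclideanSpace ℝ (Fin n ⊕ Fin n)) :
    ∃ v, ‖v‖ = 1 ∧ ∀ u, inner ℝ (i u) v = 0 := by
  obtain ⟨z, hz⟩ : ∃ z, z ∉ LinearMap.range i.toLinearMap := by
    by_contra! h
    have h1 := LinearMap.finrank_range_of_inj (f := i.toLinearMap) i.injective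
    rw [Submodule.eq_top_iff'.2 h, finrank_top, finrank_euclideanSpace,
      finrank_euclideanSpace] at h1
    simp only [Fintype.card_sum, Fintype.card_fin] at h1
    omega
  obtain ⟨b, hb⟩ := exists_forall_inner_sub_eq_zero i z
  have hne : z - i b ≠ 0 := fun h => hz ⟨b, (sub_eq_zero.1 h).symm⟩
  refine ⟨‖z - i b‖⁻¹ • (z - i b), norm_smul_inv_norm (𝕜 := ℝ) hne, fun u => ?_⟩
  rw [inner_smul_right, hb, mul_zero]

/-- On a vertical subgroup of dimension `m + 1` of codimension at least one, the Euclidean Hausdorff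
measure is a multiple of the spherical measure, with a factor that depends on `m` only. -/
theorem maxSection_mul_sphericalMeasure (hρ : IsHomogeneousDistance ρ)
    (hrot : IsRotationallyInvariant ρ) {P : Subgroup (Heis n)} {m : ℕ} (hm : m < 2 * n)
    (i : EuclideanSpace ℝ (Fin m) →ₗᵢ[ℝ] EuclideanSpace ℝ (Fin n ⊕ Fin n))
    (hP : ∀ p, p ∈ P ↔ p.z ∈ Set.range i) (A : Set (Heis n)) :
    maxSection ρ m / 2 ^ (m + 2) * sphericalMeasure ρ ((m + 2 : ℕ) : ℝ) (A ∩ P) =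
      euclideanMeasure (m + 1) (A ∩ P) := by
  have hn : 0 < n := by omega
  let _ := hρ.metricSpace
  let _ : MeasurableSpace (Heis n) := borel _
  have : BorelSpace (Heis n) := ⟨rfl⟩
  obtain ⟨e, he⟩ := hρ.exists_homeomorph_toEuclidean hrot hn
  have : SecondCountableTopology (Heis n) := e.secondCountableTopology
  have hemb : MeasurableEmbedding (toEuclidean : Heis n → _) := he ▸ e.measurableEmbedding
  have hPclosed : IsClosed (P : Set (Heis n)) := by
    have hset : (P : Set (Heis n)) =
        e ⁻¹' ((fun x => x.fst) ⁻¹' (LinearMap.range i.toLinearMap : Set _)) := by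
      ext p
      rw [he]
      exact hP p
    rw [hset]
    exact ((Submodule.closed_of_finiteDimensional _).preimage (by fun_prop)).preimage e.continuous
  let μ : Measure (Heis n) := (Measure.comap toEuclidean μHE[m + 1]).restrict P
  have hμ : ∀ S, μ S = euclideanMeasure (m + 1) (S ∩ P) := fun S => by
    rw [Measure.restrict_apply' hPclosed.measurableSet, hemb.comap_apply, euclideanMeasure]
  have hμball : ∀ p b, (∀ u, inner ℝ (i u) (p.z - i b) = 0) → ∀ r, 0 < r →
      μ (Metric.closedBall p r) =
        ENNReal.ofReal r ^ (m + 2) * volume (ballSection ρ m (r⁻¹ * ‖p.z - i b‖) 1) := by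
    intro p b hb r hr
    rw [hμ, ← euclideanMeasure_cBall_inter hρ hrot i hP p hb hr]
    congr 2
    ext q
    rw [Metric.mem_closedBall, dist_comm]
    rfl
  have hscale : ∀ (b : ℝ≥0∞) (r : ℝ),
      b / 2 ^ (m + 2) * ENNReal.ofReal (2 * r) ^ ((m + 2 : ℕ) : ℝ) = ENNReal.ofReal r ^ (m + 2) * b := by
    intro b r
    rw [ENNReal.rpow_natCast, ENNReal.ofReal_mul two_pos.le, mul_pow, ENNReal.ofReal_ofNat,
      ← mul_assoc, ENNReal.div_mul_cancel (by simp) (by simp), mul_comm]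
  have hupper : ∀ p r, 0 < r → μ (Metric.closedBall p r) ≤
      maxSection ρ m / 2 ^ (m + 2) * ENNReal.ofReal (2 * r) ^ ((m + 2 : ℕ) : ℝ) := by
    intro p r hr
    obtain ⟨b, hb⟩ := exists_forall_inner_sub_eq_zero i p.z
    rw [hμball p b hb r hr, hscale]
    gcongr
    exact le_iSup (fun a : ℝ => volume (ballSection ρ m a 1)) _
  have htop : maxSection ρ m ≠ ∞ := maxSection_ne_top hρ hrot hn m
  have : IsLocallyFiniteMeasure μ := by
    refine ⟨fun p => ⟨_, Metric.closedBall_mem_nhds p one_pos, ?_⟩⟩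
    refine (hupper p 1 one_pos).trans_lt ?_
    rw [hscale]
    finiteness
  obtain ⟨v, hv, hiv⟩ := exists_unit_forall_inner_eq_zero hm i
  obtain ⟨K, -, hK⟩ := hρ.exists_horizontal_norm_eq hrot hn
  have hlower : ∀ η < maxSection ρ m / 2 ^ (m + 2), ∃ R : ℝ, ∀ x ∈ A ∩ P, ∀ r, 0 < r →
      ∃ p, dist p x ≤ R * r ∧
        η * ENNReal.ofReal (2 * r) ^ ((m + 2 : ℕ) : ℝ) ≤ μ (Metric.closedBall p r) := by
    intro η hη
    have hη' : η * 2 ^ (m + 2) < maxSection ρ m := by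
      rwa [ENNReal.lt_div_iff_mul_lt (by simp) (by simp)] at hη
    obtain ⟨a, ha⟩ := lt_iSup_iff.1 hη'
    -- Moving `x` by `r a` along the normal `v` gives a centre at `ρ`-distance `K |a| r` from `x`
    -- whose section, rescaled to radius 1, is the near-maximal one for `a`.
    refine ⟨K * |a|, fun x hx r hr => ?_⟩
    obtain ⟨b, hb⟩ := (hP x).1 hx.2
    have hz : (x * ⟨(r * a) • v, 0⟩ : Heis n).z - i b = (r * a) • v := by
      rw [mul_z, hb]
      abel
    refine ⟨x * ⟨(r * a) • v, 0⟩, le_of_eq ?_, ?_⟩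
    · rw [dist_comm]
      have h := hρ.left_invariant x 1 ⟨(r * a) • v, 0⟩
      rw [mul_one] at h
      refine h.trans ?_
      rw [hK, norm_smul, hv, norm_mul, Real.norm_of_nonneg hr.le, Real.norm_eq_abs]
      ring
    · rw [hμball _ b (fun u => by rw [hz, inner_smul_right, hiv, mul_zero]) r hr, hz, norm_smul, hv,
        mul_one, norm_mul, Real.norm_of_nonneg hr.le, inv_mul_cancel_left₀ hr.ne',
        Real.norm_eq_abs]
      have habs : ballSection ρ m |a| 1 = ballSection ρ m a 1 := by simp [ballSection, sq_abs]
      rw [habs, ← hscale]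
      gcongr
      rw [ENNReal.le_div_iff_mul_le (by simp) (by simp)]
      exact ha.le
  have hmain := mul_iSup_ballPremeasure_eq (μ := μ) (d := ((m + 2 : ℕ) : ℝ)) (by positivity)
    (ENNReal.div_ne_zero.2 ⟨maxSection_ne_zero hρ hrot hn m, by simp⟩)
    (ENNReal.div_ne_top htop (by simp)) hupper hlower
  rw [sphericalMeasure_eq_iSup_ballPremeasure hρ, hmain, hμ, Set.inter_assoc, Set.inter_self]

end Heis

theorem mainTheorem7 (n k : ℕ) (hk : 1 ≤ k) (hkn : k ≤ n) (ρ : Heis n → Heis n → ℝ)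
    (hρ : Heis.IsHomogeneousDistance ρ) (hrot : Heis.IsRotationallyInvariant ρ) :
    ∃ c : ℝ≥0, 0 < c ∧ ∀ P : Subgroup (Heis n),
      (P ∈ Heis.tangentSubgroups n k ∨
        (Heis.IsVertical P ∧ Heis.topDim P = 2 * n + 1 - k)) →
      ∀ A : Set (Heis n),
        (c : ℝ≥0∞) * Heis.sphericalMeasure ρ (2 * (n : ℝ) + 2 - k) (A ∩ P) =
          Heis.euclideanMeasure (2 * n + 1 - k) (A ∩ P) := by
  have hn : 0 < n := by omega
  have htop : Heis.maxSection ρ (2 * n - k) / 2 ^ (2 * n - k + 2) ≠ ∞ :=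
    ENNReal.div_ne_top (Heis.maxSection_ne_top hρ hrot hn _) (by simp)
  have hzero : Heis.maxSection ρ (2 * n - k) / 2 ^ (2 * n - k + 2) ≠ 0 :=
    ENNReal.div_ne_zero.2 ⟨Heis.maxSection_ne_zero hρ hrot hn _, by simp⟩
  refine ⟨_, ENNReal.toNNReal_pos hzero htop, fun P hP A => ?_⟩
  obtain ⟨W, hdim, hW⟩ := Heis.exists_submodule_of_tangent_or_vertical hkn hP
  -- An orthonormal basis parametrizes `W` isometrically by `ℝᵐ` with `m = 2n - k`.
  let f := ((stdOrthonormalBasis ℝ W).reindex (finCongr hdim)).repr.symm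
  have hrange : ∀ p, p ∈ P ↔ p.z ∈ Set.range (W.subtypeₗᵢ.comp f.toLinearIsometry) := by
    intro p
    rw [hW]
    constructor
    · intro h
      exact ⟨f.symm ⟨p.z, h⟩, by simp⟩
    · rintro ⟨u, hu⟩
      rw [← hu]
      exact (f u).2
  have hmain := Heis.maxSection_mul_sphericalMeasure hρ hrot (by omega) _ hrange A
  have hd : ((2 * n - k + 2 : ℕ) : ℝ) = 2 * (n : ℝ) + 2 - k := by
    rw [Nat.cast_add, Nat.cast_sub (by omega)]
    push_cast
    ring
  rw [ENNReal.coe_toNNReal htop, ← hd, hmain]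
  congr 1
  omega
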